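/- **Theorem 4.1.** Let $p\in(1,2]$ and let $g\in L^2(\mathbb R^3)$ be real-valued (not necessarily radial). For $\lambda>0$ consider the system $$-\Delta u+u+\lambda\phi u=|u|^{p-1}u+g,\qquad -\Delta\phi=u^2\qquad\text{in }\mathbb R^3,\tag{SM}$$ whose solutions are the pairs $(u,\phi)\in H^1(\mathbb R^3)\times D^{1,2}(\mathbb R^3)$ of real functions satisfying both equations in the weak sense. For $u\in H^1(\mathbb R^3)$ let $\phi_u$ be the unique weak solution in $D^{1,2}(\mathbb R^3)$ of $-\Delta\phi=u^2$, and define the energy $$I_\lambda(u)=\frac12\int_{\mathbb R^3}\big(|\nabla u|^2+u^2\big)\,dx+\frac\lambda4\int_{\mathbb R^3}\phi_u u^2\,dx-\frac1{p+1}\int_{\mathbb R^3}|u|^{p+1}\,dx-\int_{\mathbb R^3}g\,u\,dx .$$ Then there is $\lambda_0>0$ such that for every $\lambda\ge\lambda_0$ the system (SM) has no solution $(u,\phi)$ with $I_\lambda(u)>0$. -/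

import Mathlib

open MeasureTheory
open scoped Gradient ContDiff

namespace SchrodingerMaxwell

/-- The Euclidean space `ℝ³`. -/
abbrev R3 : Type := EuclideanSpace ℝ (Fin 3)

/-- Test functions: real-valued functions in `C_c^∞(ℝ³)`. -/
def IsTestFunction (v : R3 → ℝ) : Prop :=
  ContDiff ℝ ∞ v ∧ HasCompactSupport v

/-- `G` is a weak (distributional) gradient of `u` on `ℝ³`. -/
def HasWeakGradient (u : R3 → ℝ) (G : R3 → R3) : Prop :=
  LocallyIntegrable u ∧ LocallyIntegrable G ∧
    ∀ v : R3 → ℝ, IsTestFunction v → ∫ x, u x • (∇ v) x = - ∫ x, v x • G x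

open Classical in
/-- The weak gradient of `u`, well defined up to a null set whenever it exists
(and zero by convention otherwise). -/
noncomputable def weakGradient (u : R3 → ℝ) : R3 → R3 :=
  if h : ∃ G, HasWeakGradient u G then h.choose else 0

/-- The Sobolev space `H¹(ℝ³)` of real functions: `u ∈ L²` with weak gradient in `L²`. -/
def MemH1 (u : R3 → ℝ) : Prop :=
  MemLp u 2 ∧ ∃ G, HasWeakGradient u G ∧ MemLp G 2

/-- The homogeneous Sobolev space `D^{1,2}(ℝ³)` (completion of `C_c^∞` for the norm
`‖∇φ‖_{L²}`), realised as the functions in `L⁶`, `6` being the critical Sobolev exponent in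
dimension three, with weak gradient in `L²`. -/
def MemD12 (φ : R3 → ℝ) : Prop :=
  MemLp φ 6 ∧ ∃ G, HasWeakGradient φ G ∧ MemLp G 2

/-- `φ ∈ D^{1,2}(ℝ³)` is a weak solution of the Maxwell equation `-Δφ = u²` on `ℝ³`. -/
def SolvesMaxwell (u φ : R3 → ℝ) : Prop :=
  MemD12 φ ∧ ∀ v : R3 → ℝ, IsTestFunction v →
    ∫ x, inner ℝ (weakGradient φ x) ((∇ v) x) = ∫ x, u x ^ 2 * v x

open Classical in
/-- The potential `φ_u`: for `u ∈ H¹(ℝ³)`, the (a.e. unique) solution in `D^{1,2}(ℝ³)` of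
`-Δφ = u²`. -/
noncomputable def potential (u : R3 → ℝ) : R3 → ℝ :=
  if h : ∃ φ, SolvesMaxwell u φ then h.choose else 0

/-- The energy functional `I_λ` on `H¹(ℝ³)`:
`I_λ(u) = ½ ∫ (|∇u|² + u²) + (λ/4) ∫ φ_u u² - 1/(p+1) ∫ |u|^{p+1} - ∫ g u`. -/
noncomputable def energy (lam p : ℝ) (g u : R3 → ℝ) : ℝ :=
  1 / 2 * (∫ x, (‖weakGradient u x‖ ^ 2 + u x ^ 2))
    + lam / 4 * (∫ x, potential u x * u x ^ 2)
    - 1 / (p + 1) * (∫ x, |u x| ^ (p + 1))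
    - ∫ x, g x * u x

/-- `φ ∈ D^{1,2}(ℝ³)`, `u ∈ H¹(ℝ³)` and `(u, φ)` is a weak solution of the system
`-Δu + u + λ φ u = |u|^{p-1} u + g`, `-Δφ = u²` on `ℝ³`. -/
structure IsSolution (lam p : ℝ) (g u φ : R3 → ℝ) : Prop where
  memH1 : MemH1 u
  maxwell : SolvesMaxwell u φ
  schrodinger : ∀ v : R3 → ℝ, IsTestFunction v →
    (∫ x, inner ℝ (weakGradient u x) ((∇ v) x)) + (∫ x, u x * v x)
        + lam * (∫ x, φ x * u x * v x)
      = (∫ x, |u x| ^ (p - 1) * u x * v x) + ∫ x, g x * v x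

end SchrodingerMaxwell

/-!
Testing the Schrödinger equation with `u` itself and eliminating `∫ g u` turns the energy into
`I_λ(u) = p/(p+1) ∫ |u|^{p+1} - ½ ∫ (|∇u|² + u²) - ¾ λ ∫ |∇φ|²`, in which `g` no longer appears; here
`∫ φ_u u² = ∫ |∇φ|²` by the Maxwell equation. Testing the Maxwell equation with `|u|` gives
`∫ |u|³ ≤ ∫ |∇φ| |∇u|`, and since `1 < p ≤ 2` there is a constant `K`, depending only on `p`, with
`|u|^{p+1} ≤ ½ u² + K |u|³`. By Young's inequality
`∫ |u|^{p+1} ≤ ½ ∫ (|∇u|² + u²) + ½ K² ∫ |∇φ|²`, so that `I_λ(u) ≤ 0` as soon as `λ ≥ K²`.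

The two equations are only given for smooth compactly supported test functions. To test them with
elements of `H¹` and `D^{1,2}` one needs the density of test functions in both spaces
(`exists_seq_testFunction_tendsto`, by mollification and cutoff) and the embedding `H¹ ⊆ L⁶`
(`MemH1.memLp_six`), which makes all nonlinear terms continuous along the approximating sequences.
The identities are `IsSolution.nehari`, `SolvesMaxwell.integral_potential` and
`SolvesMaxwell.integral_abs_pow_three_le`; they are combined in `IsSolution.energy_nonpos`.
-/

namespace SchrodingerMaxwell

open Filter Set Metric ContinuousLinearMap
open scoped Topology ENNReal Convolution Pointwise

/-! ### Mollification in `Lᵖ` -/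

section Mollification

variable {E F : Type*} [NormedAddCommGroup E] [NormedSpace ℝ E] [FiniteDimensional ℝ E]
  [MeasurableSpace E] [BorelSpace E] [NormedAddCommGroup F] [NormedSpace ℝ F]
  {μ : Measure E} [μ.IsAddHaarMeasure]

/-- Mollification is a contraction of `Lᵖ`. -/
theorem eLpNorm_normed_convolution_le (ρ : ContDiffBump (0 : E)) {p : ℝ≥0∞} (hp : 1 ≤ p)
    (hp' : p ≠ ⊤) {g : E → F} (hg : AEStronglyMeasurable g μ) :
    eLpNorm (ρ.normed μ ⋆[lsmul ℝ ℝ, μ] g) p μ ≤ eLpNorm g p μ := by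
  have hp0 : p ≠ 0 := (zero_lt_one.trans_le hp).ne'
  have hpr : 0 < p.toReal := ENNReal.toReal_pos hp0 hp'
  set k : E → ℝ≥0∞ := fun t => ‖ρ.normed μ t‖ₑ with hk
  have hkm : Measurable k := ρ.continuous_normed.measurable.enorm
  have hk1 : ∫⁻ t, k t ∂μ = 1 := by
    have h := ofReal_integral_eq_lintegral_ofReal (ρ.integrable_normed (μ := μ))
      (Eventually.of_forall ρ.nonneg_normed)
    rw [ρ.integral_normed, ENNReal.ofReal_one] at h
    rw [h]
    exact lintegral_congr fun t => Real.enorm_of_nonneg (ρ.nonneg_normed t)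
  have hν : IsProbabilityMeasure (μ.withDensity k) :=
    ⟨by rw [withDensity_apply _ MeasurableSet.univ, setLIntegral_univ, hk1]⟩
  -- Jensen's inequality for the probability measure with density `ρ`
  have key : ∀ x, ‖(ρ.normed μ ⋆[lsmul ℝ ℝ, μ] g) x‖ₑ ^ p.toReal
      ≤ ∫⁻ t, k t * ‖g (x - t)‖ₑ ^ p.toReal ∂μ := by
    intro x
    have hgx : AEStronglyMeasurable (fun t => g (x - t)) μ :=
      hg.comp_quasiMeasurePreserving (quasiMeasurePreserving_sub_left_of_right_invariant μ x)
    have hgν : AEStronglyMeasurable (fun t => g (x - t)) (μ.withDensity k) :=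
      hgx.mono_ac (withDensity_absolutelyContinuous _ _)
    have h1 : ‖(ρ.normed μ ⋆[lsmul ℝ ℝ, μ] g) x‖ₑ
        ≤ eLpNorm (fun t => g (x - t)) 1 (μ.withDensity k) := by
      rw [eLpNorm_one_eq_lintegral_enorm, lintegral_withDensity_eq_lintegral_mul₀ hkm.aemeasurable
        hgx.enorm]
      refine (enorm_integral_le_lintegral_enorm _).trans_eq (lintegral_congr fun t => ?_)
      simp [hk, enorm_smul]
    have h2 := h1.trans (eLpNorm_le_eLpNorm_of_exponent_le hp hgν)
    rw [eLpNorm_eq_lintegral_rpow_enorm_toReal hp0 hp',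
      lintegral_withDensity_eq_lintegral_mul₀ hkm.aemeasurable (hgx.enorm.pow_const _)] at h2
    have h3 := ENNReal.rpow_le_rpow h2 hpr.le
    rwa [← ENNReal.rpow_mul, one_div, inv_mul_cancel₀ hpr.ne', ENNReal.rpow_one] at h3
  rw [eLpNorm_eq_lintegral_rpow_enorm_toReal hp0 hp',
    eLpNorm_eq_lintegral_rpow_enorm_toReal hp0 hp']
  refine ENNReal.rpow_le_rpow ((lintegral_mono key).trans ?_) (by positivity)
  have hm : AEMeasurable (fun z : E × E => k z.2 * ‖g (z.1 - z.2)‖ₑ ^ p.toReal) (μ.prod μ) := by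
    refine (hkm.comp measurable_snd).aemeasurable.mul (AEMeasurable.pow_const ?_ _)
    exact (hg.comp_quasiMeasurePreserving (quasiMeasurePreserving_sub_of_right_invariant μ μ)).enorm
  rw [lintegral_lintegral_swap hm]
  have : ∀ t, ∫⁻ x, k t * ‖g (x - t)‖ₑ ^ p.toReal ∂μ = k t * ∫⁻ x, ‖g x‖ₑ ^ p.toReal ∂μ := by
    intro t
    rw [lintegral_const_mul' _ _ (by simp [hk])]
    congr 1
    exact lintegral_sub_right_eq_self (fun x => ‖g x‖ₑ ^ p.toReal) t
  simp_rw [this]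
  rw [lintegral_mul_const _ hkm, hk1, one_mul]

/-- Mollification converges in `Lᵖ`: the claim for continuous compactly supported functions follows
from uniform continuity, and mollification is a contraction of `Lᵖ`. -/
theorem exists_eLpNorm_normed_convolution_sub_le {p : ℝ≥0∞} (hp : 1 ≤ p) (hp' : p ≠ ⊤)
    [CompleteSpace F] {f : E → F} (hf : MemLp f p μ) {ε : ℝ≥0∞} (hε : ε ≠ 0) :
    ∃ δ : ℝ, 0 < δ ∧ ∀ ρ : ContDiffBump (0 : E), ρ.rOut < δ →
      eLpNorm (ρ.normed μ ⋆[lsmul ℝ ℝ, μ] f - f) p μ ≤ ε := by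
  have hp0 : p ≠ 0 := (zero_lt_one.trans_le hp).ne'
  have hε3 : ε / 3 ≠ 0 := (ENNReal.div_pos hε (by simp)).ne'
  obtain ⟨g, hgc, hfg, hgcont, hgp⟩ := hf.exists_hasCompactSupport_eLpNorm_sub_le hp' hε3
  set K : Set E := cthickening 1 (tsupport g) with hK
  have hKc : IsCompact K := hgc.isCompact.cthickening
  obtain ⟨η, hη, hηK⟩ : ∃ η : ℝ, 0 < η ∧ ENNReal.ofReal η * μ K ^ (1 / p.toReal) ≤ ε / 3 := by
    have hfin : μ K ^ (1 / p.toReal) ≠ ⊤ :=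
      ENNReal.rpow_ne_top_of_nonneg (by positivity) hKc.measure_lt_top.ne
    have ht : Tendsto (fun η : ℝ => ENNReal.ofReal η * μ K ^ (1 / p.toReal)) (𝓝[>] 0) (𝓝 0) := by
      have := ENNReal.Tendsto.mul_const (b := μ K ^ (1 / p.toReal))
        (ENNReal.tendsto_ofReal (tendsto_id (x := 𝓝 (0 : ℝ)))) (Or.inr hfin)
      simp only [id, ENNReal.ofReal_zero, zero_mul] at this
      exact this.mono_left nhdsWithin_le_nhds
    obtain ⟨η, h1, h2⟩ := ((ht.eventually_le_const hε3.bot_lt).and self_mem_nhdsWithin).exists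
    exact ⟨η, h2, h1⟩
  obtain ⟨δ, hδ, hδg⟩ := Metric.uniformContinuous_iff.1
    (hgc.uniformContinuous_of_continuous hgcont) η hη
  refine ⟨min δ 1, by positivity, fun ρ hρ => ?_⟩
  have hsub : ∀ x, dist ((ρ.normed μ ⋆[lsmul ℝ ℝ, μ] g) x) (g x) ≤ η := fun x =>
    ρ.dist_normed_convolution_le hgcont.aestronglyMeasurable fun y hy =>
      (hδg ((mem_ball.1 hy).trans (hρ.trans_le (min_le_left _ _)))).le
  have hsupp : Function.support (ρ.normed μ ⋆[lsmul ℝ ℝ, μ] g) ⊆ K := by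
    intro x hx
    by_contra hxK
    refine hx ?_
    have h0 : ∀ y ∈ ball x ρ.rOut, g y = 0 := fun y hy => by
      by_contra hy0
      refine hxK (mem_cthickening_of_dist_le x y 1 _ (subset_tsupport g hy0) ?_)
      rw [dist_comm]
      exact ((mem_ball.1 hy).trans (hρ.trans_le (min_le_right _ _))).le
    rw [ρ.normed_convolution_eq_right fun y hy => by
      rw [h0 y hy, h0 x (mem_ball_self ρ.rOut_pos)], h0 x (mem_ball_self ρ.rOut_pos)]
  have hgK : Function.support g ⊆ K :=
    (subset_tsupport g).trans (self_subset_cthickening _)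
  have hg3 : eLpNorm (ρ.normed μ ⋆[lsmul ℝ ℝ, μ] g - g) p μ ≤ ε / 3 :=
    (eLpNorm_sub_le_of_dist_bdd μ hp' hKc.measurableSet hη.le hsub hsupp hgK).trans hηK
  have hex : ∀ {h : E → F}, LocallyIntegrable h μ →
      ConvolutionExists (ρ.normed μ) h (lsmul ℝ ℝ) μ := fun hh =>
    ρ.hasCompactSupport_normed.convolutionExists_left _ ρ.continuous_normed hh
  have hcont : ∀ {h : E → F}, LocallyIntegrable h μ →
      Continuous (ρ.normed μ ⋆[lsmul ℝ ℝ, μ] h) := fun hh =>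
    ρ.hasCompactSupport_normed.continuous_convolution_left _ ρ.continuous_normed hh
  have hfgm : MemLp (f - g) p μ := hf.sub hgp
  have hdec : ρ.normed μ ⋆[lsmul ℝ ℝ, μ] f - f
      = (ρ.normed μ ⋆[lsmul ℝ ℝ, μ] (f - g)) + ((ρ.normed μ ⋆[lsmul ℝ ℝ, μ] g - g) - (f - g)) := by
    have : ρ.normed μ ⋆[lsmul ℝ ℝ, μ] f = (ρ.normed μ ⋆[lsmul ℝ ℝ, μ] (f - g))
        + (ρ.normed μ ⋆[lsmul ℝ ℝ, μ] g) := by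
      rw [← ConvolutionExists.distrib_add (hex (hfgm.locallyIntegrable hp))
        (hex (hgp.locallyIntegrable hp)), sub_add_cancel]
    rw [this]; abel
  have hm1 := (hcont (hfgm.locallyIntegrable hp)).aestronglyMeasurable (μ := μ)
  have hm2 := ((hcont (hgp.locallyIntegrable hp)).aestronglyMeasurable (μ := μ)).sub hgp.1
  rw [hdec]
  calc _ ≤ eLpNorm (ρ.normed μ ⋆[lsmul ℝ ℝ, μ] (f - g)) p μ
        + (eLpNorm (ρ.normed μ ⋆[lsmul ℝ ℝ, μ] g - g) p μ + eLpNorm (f - g) p μ) :=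
      (eLpNorm_add_le hm1 (hm2.sub hfgm.1) hp).trans
        (add_le_add le_rfl (eLpNorm_sub_le hm2 hfgm.1 hp))
    _ ≤ ε / 3 + (ε / 3 + ε / 3) := by
      gcongr
      exact (eLpNorm_normed_convolution_le ρ hp hp' hfgm.1).trans hfg
    _ = ε := by rw [← add_assoc, ENNReal.add_thirds]

end Mollification

/-! ### Gradients of smooth functions and of mollifications -/

theorem inner_gradient {v : R3 → ℝ} (x y : R3) : inner ℝ ((∇ v) x) y = fderiv ℝ v x y := by
  simp [gradient]

theorem norm_gradient {v : R3 → ℝ} (x : R3) : ‖(∇ v) x‖ = ‖fderiv ℝ v x‖ := by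
  simp [gradient]

theorem continuous_gradient {v : R3 → ℝ} (hv : ContDiff ℝ ∞ v) : Continuous (∇ v) :=
  (InnerProductSpace.toDual ℝ R3).symm.continuous.comp (hv.continuous_fderiv (by simp))

theorem HasCompactSupport.gradient {v : R3 → ℝ} (hv : HasCompactSupport v) :
    HasCompactSupport (∇ v) :=
  (hv.fderiv ℝ).comp_left (g := (InnerProductSpace.toDual ℝ R3).symm) (map_zero _)

theorem IsTestFunction.memLp {v : R3 → ℝ} (hv : IsTestFunction v) (p : ℝ≥0∞) : MemLp v p :=
  hv.1.continuous.memLp_of_hasCompactSupport hv.2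

theorem IsTestFunction.memLp_gradient {v : R3 → ℝ} (hv : IsTestFunction v) (p : ℝ≥0∞) :
    MemLp (∇ v) p :=
  (continuous_gradient hv.1).memLp_of_hasCompactSupport (HasCompactSupport.gradient hv.2)

theorem gradient_mul {f g : R3 → ℝ} {x : R3} (hf : DifferentiableAt ℝ f x)
    (hg : DifferentiableAt ℝ g x) :
    (∇ fun y => f y * g y) x = f x • (∇ g) x + g x • (∇ f) x := by
  refine ext_inner_right ℝ fun y => ?_
  rw [inner_gradient, fderiv_fun_mul hf hg]
  simp [inner_add_left, inner_smul_left]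

/-- Weak differentiation commutes with mollification. -/
theorem gradient_normed_convolution (ρ : ContDiffBump (0 : R3)) {u : R3 → ℝ} {G : R3 → R3}
    (hG : HasWeakGradient u G) :
    ∇ (ρ.normed volume ⋆[lsmul ℝ ℝ] u) = ρ.normed volume ⋆[lsmul ℝ ℝ] G := by
  obtain ⟨hu, hGl, hw⟩ := hG
  have hρ : ContDiff ℝ ∞ (ρ.normed (volume : Measure R3)) := ρ.contDiff_normed
  have hρc : HasCompactSupport (ρ.normed (volume : Measure R3)) := ρ.hasCompactSupport_normed
  ext1 x
  -- the translated and reflected kernel is the test function to use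
  have hshift : IsTestFunction fun t => ρ.normed volume (x - t) :=
    ⟨hρ.comp (contDiff_const.sub contDiff_id), hρc.comp_homeomorph (Homeomorph.subLeft x)⟩
  have hgr : ∀ t, (∇ fun t => ρ.normed volume (x - t)) t
      = -(∇ (ρ.normed (volume : Measure R3))) (x - t) := by
    intro t
    refine ext_inner_right ℝ fun y => ?_
    rw [inner_gradient, inner_neg_left, inner_gradient]
    have h1 : HasFDerivAt (ρ.normed (volume : Measure R3)) (fderiv ℝ (ρ.normed volume) (x - t))
        (x - t) := (hρ.differentiable (by simp) _).hasFDerivAt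
    have h2 : HasFDerivAt (fun t : R3 => x - t) (-ContinuousLinearMap.id ℝ R3) t :=
      (hasFDerivAt_id t).const_sub x
    rw [show fderiv ℝ (fun t => ρ.normed volume (x - t)) t = _ from (h1.comp t h2).fderiv]
    simp
  have hT := hw _ hshift
  simp only [hgr, smul_neg] at hT
  rw [integral_neg, neg_inj] at hT
  rw [convolution_eq_swap]
  simp only [lsmul_apply]
  rw [← hT]
  refine ext_inner_right ℝ fun y => ?_
  have hd := hρc.hasFDerivAt_convolution_left (lsmul ℝ ℝ) (hρ.of_le (by simp)) hu x
  have hint : Integrable fun t => u t • (∇ (ρ.normed (volume : Measure R3))) (x - t) := by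
    have hc : HasCompactSupport fun t => (∇ (ρ.normed (volume : Measure R3))) (x - t) :=
      (HasCompactSupport.gradient hρc).comp_homeomorph (Homeomorph.subLeft x)
    have hcc : Continuous fun t => (∇ (ρ.normed (volume : Measure R3))) (x - t) :=
      (continuous_gradient hρ).comp (continuous_const.sub continuous_id)
    exact hu.integrable_smul_right_of_hasCompactSupport hcc hc
  rw [inner_gradient, hd.fderiv, convolution_eq_swap]
  have hint2 : Integrable fun t =>
      ((lsmul ℝ ℝ).precompL R3 (fderiv ℝ (ρ.normed volume) (x - t))) (u t) := by
    have := (hρc.fderiv ℝ).convolutionExists_left ((lsmul ℝ ℝ : ℝ →L[ℝ] ℝ →L[ℝ] ℝ).precompL R3)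
      (hρ.continuous_fderiv (by simp)) hu x
    exact this.integrable_swap
  rw [ContinuousLinearMap.integral_apply hint2, real_inner_comm, ← integral_inner hint]
  refine integral_congr_ae (Eventually.of_forall fun t => ?_)
  simp only [precompL_apply, lsmul_apply, smul_eq_mul, inner_smul_right]
  rw [real_inner_comm, inner_gradient, mul_comm]

/-! ### Density of test functions -/

theorem exists_eLpNorm_indicator_compl_ball_le {F : Type*} [NormedAddCommGroup F] [NormedSpace ℝ F]
    {p : ℝ≥0∞} (hp : p ≠ ⊤) {f : R3 → F} (hf : MemLp f p) {ε : ℝ≥0∞} (hε : ε ≠ 0) :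
    ∃ R₀ : ℝ, ∀ R, R₀ ≤ R → eLpNorm ((ball (0 : R3) R)ᶜ.indicator f) p ≤ ε := by
  obtain ⟨g, hgc, hfg, -, -⟩ := hf.exists_hasCompactSupport_eLpNorm_sub_le hp hε
  obtain ⟨R₀, hR₀⟩ := hgc.isCompact.isBounded.subset_ball (0 : R3)
  refine ⟨R₀, fun R hR => le_trans ?_ hfg⟩
  have : (ball (0 : R3) R)ᶜ.indicator f = (ball (0 : R3) R)ᶜ.indicator (f - g) := by
    refine indicator_congr fun x hx => ?_
    have : g x = 0 := by
      by_contra h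
      exact hx (ball_subset_ball hR (hR₀ (subset_tsupport g h)))
    simp [this]
  rw [this]
  exact eLpNorm_indicator_le _

/-- The gradient of a cutoff `x ↦ χ (x / R)` is bounded in `Lʳ` uniformly in `R ≥ 1` if `r` is at
least the dimension. -/
theorem exists_eLpNorm_gradient_cutoff_le {χ : R3 → ℝ} (hχ : IsTestFunction χ) {r : ℝ≥0∞}
    (hr : 3 ≤ r) :
    ∃ C : ℝ≥0∞, C ≠ ⊤ ∧ ∀ R : ℝ, 1 ≤ R → eLpNorm (∇ fun x => χ (R⁻¹ • x)) r ≤ C := by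
  have hc := continuous_gradient hχ.1
  have hcs := HasCompactSupport.gradient hχ.2
  obtain ⟨M, hM⟩ := hcs.exists_bound_of_continuous hc
  have hM0 : 0 ≤ M := (norm_nonneg _).trans (hM 0)
  obtain ⟨a, ha⟩ := hcs.isCompact.isBounded.subset_closedBall (0 : R3)
  have hr3 : r.toReal⁻¹ * 3 ≤ 1 := by
    rcases eq_or_ne r ⊤ with rfl | h
    · simp
    · have h3 : (3 : ℝ) ≤ r.toReal := by simpa using ENNReal.toReal_mono h hr
      rw [inv_mul_le_iff₀ (by linarith)]
      linarith
  refine ⟨volume (closedBall (0 : R3) a) ^ r.toReal⁻¹ * ENNReal.ofReal M,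
    ENNReal.mul_ne_top (ENNReal.rpow_ne_top_of_nonneg (by positivity)
      measure_closedBall_lt_top.ne) ENNReal.ofReal_ne_top, fun R hR => ?_⟩
  have hR0 : 0 < R := one_pos.trans_le hR
  have hgr : (∇ fun x => χ (R⁻¹ • x)) = fun x => R⁻¹ • (∇ χ) (R⁻¹ • x) := by
    ext1 x
    refine ext_inner_right ℝ fun y => ?_
    have h1 : HasFDerivAt χ (fderiv ℝ χ (R⁻¹ • x)) (R⁻¹ • x) :=
      (hχ.1.differentiable (by simp) _).hasFDerivAt
    have h2 : HasFDerivAt (fun x : R3 => R⁻¹ • x) (R⁻¹ • ContinuousLinearMap.id ℝ R3) x :=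
      (hasFDerivAt_id x).const_smul R⁻¹
    rw [inner_gradient, inner_smul_left, inner_gradient,
      show fderiv ℝ (fun x => χ (R⁻¹ • x)) x = _ from (h1.comp x h2).fderiv]
    simp
  have hsupp : Function.support (fun x => R⁻¹ • (∇ χ) (R⁻¹ • x)) ⊆ R • closedBall (0 : R3) a := by
    intro x hx
    rw [mem_smul_set_iff_inv_smul_mem₀ hR0.ne']
    refine ha (subset_tsupport _ fun h => hx ?_)
    simp [h]
  rw [hgr, ← eLpNorm_restrict_eq_of_support_subset hsupp]
  refine (eLpNorm_le_of_ae_bound (C := R⁻¹ * M) (Eventually.of_forall fun x => ?_)).trans ?_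
  · rw [norm_smul, Real.norm_of_nonneg (by positivity)]
    exact mul_le_mul_of_nonneg_left (hM _) (by positivity)
  rw [Measure.restrict_apply_univ, Measure.addHaar_smul,
    ENNReal.mul_rpow_of_nonneg _ _ (by positivity)]
  have hdim : ENNReal.ofReal |R ^ Module.finrank ℝ R3| ^ r.toReal⁻¹ ≤ ENNReal.ofReal R := by
    rw [finrank_euclideanSpace_fin, abs_of_nonneg (by positivity),
      ENNReal.ofReal_rpow_of_nonneg (by positivity) (by positivity)]
    refine ENNReal.ofReal_le_ofReal ?_
    rw [← Real.rpow_natCast, ← Real.rpow_mul hR0.le]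
    refine (Real.rpow_le_rpow_of_exponent_le hR ?_).trans_eq (Real.rpow_one R)
    rw [mul_comm]; exact_mod_cast hr3
  calc _ ≤ ENNReal.ofReal R * volume (closedBall (0 : R3) a) ^ r.toReal⁻¹
        * ENNReal.ofReal (R⁻¹ * M) := by gcongr
    _ = _ := by
      rw [ENNReal.ofReal_mul (by positivity), mul_comm (ENNReal.ofReal R), mul_assoc,
        ← mul_assoc (ENNReal.ofReal R), ← ENNReal.ofReal_mul hR0.le, mul_inv_cancel₀ hR0.ne',
        ENNReal.ofReal_one, one_mul]

/-- Cutting off a smooth function. The error term `f ∇χ` is controlled by Hölder's inequality and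
the uniform `Lʳ` bound on the gradients of the cutoffs, since only the tail of `f` enters. -/
theorem exists_testFunction_of_contDiff {q r : ℝ≥0∞} [ENNReal.HolderTriple q r 2]
    (hq' : q ≠ ⊤) (hr : 3 ≤ r) {f : R3 → ℝ} (hf : ContDiff ℝ ∞ f) (hfq : MemLp f q)
    (hf2 : MemLp (∇ f) 2) {ε : ℝ≥0∞} (hε : ε ≠ 0) :
    ∃ w, IsTestFunction w ∧ eLpNorm (w - f) q ≤ ε ∧ eLpNorm (∇ w - ∇ f) 2 ≤ ε := by
  -- `ε = ⊤` is excluded because it makes the fraction `ε / 2 / (C + 1)` useless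
  wlog hεt : ε ≠ ⊤ generalizing ε
  · obtain ⟨w, h1, h2, h3⟩ := this one_ne_zero ENNReal.one_ne_top
    rw [not_not] at hεt
    exact ⟨w, h1, by simp [hεt], by simp [hεt]⟩
  let χ : ContDiffBump (0 : R3) := ⟨1, 2, one_pos, one_lt_two⟩
  have hχ : IsTestFunction χ := ⟨χ.contDiff, χ.hasCompactSupport⟩
  obtain ⟨C, hC, hCR⟩ := exists_eLpNorm_gradient_cutoff_le hχ hr
  have hε2 : ε / 2 ≠ 0 := (ENNReal.half_pos hε).ne'
  have hε3 : ε / 2 / (C + 1) ≠ 0 := (ENNReal.div_pos hε2 (by simp [hC])).ne'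
  obtain ⟨R₁, hR₁⟩ := exists_eLpNorm_indicator_compl_ball_le hq' hfq hε
  obtain ⟨R₂, hR₂⟩ := exists_eLpNorm_indicator_compl_ball_le (by simp) hf2 hε2
  obtain ⟨R₃, hR₃⟩ := exists_eLpNorm_indicator_compl_ball_le hq' hfq hε3
  obtain ⟨R, hR⟩ : ∃ R, R₁ ≤ R ∧ R₂ ≤ R ∧ R₃ ≤ R ∧ 1 ≤ R :=
    ((eventually_ge_atTop R₁).and ((eventually_ge_atTop R₂).and
      ((eventually_ge_atTop R₃).and (eventually_ge_atTop 1)))).exists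
  obtain ⟨h1, h2, h3, h4⟩ := hR
  have hR0 : 0 < R := one_pos.trans_le h4
  set ψ : R3 → ℝ := fun x => χ (R⁻¹ • x) with hψ
  have hψc : ContDiff ℝ ∞ ψ := hχ.1.comp (contDiff_const_smul R⁻¹)
  have hψt : IsTestFunction ψ :=
    ⟨hψc, hχ.2.comp_homeomorph (Homeomorph.smulOfNeZero R⁻¹ (inv_ne_zero hR0.ne'))⟩
  have hψ1 : ∀ x ∈ ball (0 : R3) R, ψ x = 1 := fun x hx => by
    refine χ.one_of_mem_closedBall ?_
    rw [mem_ball_zero_iff] at hx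
    rw [mem_closedBall_zero_iff, norm_smul, norm_inv, Real.norm_of_nonneg hR0.le]
    exact (inv_mul_le_iff₀ hR0).2 (by simpa [χ] using hx.le)
  have hψg : ∀ x ∈ ball (0 : R3) R, (∇ ψ) x = 0 := fun x hx => by
    have : ψ =ᶠ[𝓝 x] fun _ => (1 : ℝ) :=
      Filter.eventuallyEq_of_mem (isOpen_ball.mem_nhds hx) hψ1
    rw [this.gradient_eq, gradient_fun_const]
  have hψa : ∀ x, |ψ x - 1| ≤ 1 := fun x => by
    rw [abs_sub_comm, abs_of_nonneg (sub_nonneg.2 χ.le_one)]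
    exact sub_le_self _ χ.nonneg
  have hcut : ∀ {F : Type} [NormedAddCommGroup F] [NormedSpace ℝ F] (h : R3 → F) (s : ℝ≥0∞),
      eLpNorm (fun x => (ψ x - 1) • h x) s ≤ eLpNorm ((ball (0 : R3) R)ᶜ.indicator h) s := by
    intro F _ _ h s
    refine eLpNorm_mono fun x => ?_
    by_cases hx : x ∈ ball (0 : R3) R
    · simp [hψ1 x hx]
    · rw [indicator_of_mem hx, norm_smul]
      exact mul_le_of_le_one_left (norm_nonneg _) (hψa x)
  refine ⟨fun x => ψ x * f x, ⟨hψc.mul hf, hψt.2.mul_right⟩, ?_, ?_⟩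
  · have : (fun x => ψ x * f x) - f = fun x => (ψ x - 1) • f x := by
      ext x; simp [sub_mul]
    rw [this]
    exact (hcut f q).trans (hR₁ R h1)
  · have hgr : (∇ fun x => ψ x * f x) - ∇ f = (fun x => (ψ x - 1) • (∇ f) x)
        + ((ball (0 : R3) R)ᶜ.indicator f • ∇ ψ) := by
      ext1 x
      rw [Pi.sub_apply, gradient_mul (hψc.differentiable (by simp) x)
        (hf.differentiable (by simp) x), Pi.add_apply, Pi.smul_apply', sub_smul, one_smul]
      have : (ball (0 : R3) R)ᶜ.indicator f x • (∇ ψ) x = f x • (∇ ψ) x := by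
        by_cases hx : x ∈ ball (0 : R3) R
        · simp [hψg x hx]
        · rw [indicator_of_mem hx]
      rw [this]; abel
    have hm1 : AEStronglyMeasurable ((ball (0 : R3) R)ᶜ.indicator f) :=
      hfq.1.indicator measurableSet_ball.compl
    have hm2 : AEStronglyMeasurable (∇ ψ) := (continuous_gradient hψc).aestronglyMeasurable
    have hm3 : AEStronglyMeasurable (fun x => (ψ x - 1) • (∇ f) x) :=
      ((hψc.continuous.sub continuous_const).smul
        (continuous_gradient hf)).aestronglyMeasurable
    have hm4 : AEStronglyMeasurable ((ball (0 : R3) R)ᶜ.indicator f • ∇ ψ) := hm1.smul hm2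
    rw [hgr]
    refine (eLpNorm_add_le hm3 hm4 one_le_two).trans ?_
    calc
      _ ≤ ε / 2 + ε / 2 / (C + 1) * (C + 1) := by
        refine add_le_add ?_ ?_
        · exact (hcut _ _).trans (hR₂ R h2)
        · refine (eLpNorm_smul_le_mul_eLpNorm (p := q) (q := r) hm2 hm1).trans ?_
          exact mul_le_mul' (hR₃ R h3) ((hCR R h4).trans le_self_add)
      _ = ε := by
        rw [ENNReal.div_mul_cancel (by simp) (by simp [hC]), ENNReal.add_halves]

/-- Density of test functions in the space of `L^q` functions with weak gradient in `L²`. The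
condition on the exponents is `2 ≤ q ≤ 6`. -/
theorem exists_testFunction_eLpNorm_sub_le {q : ℝ≥0∞} (r : ℝ≥0∞) [ENNReal.HolderTriple q r 2]
    (hq : 1 ≤ q) (hq' : q ≠ ⊤) (hr : 3 ≤ r) {u : R3 → ℝ} {G : R3 → R3} (hG : HasWeakGradient u G)
    (huq : MemLp u q) (hG2 : MemLp G 2) {ε : ℝ≥0∞} (hε : ε ≠ 0) :
    ∃ w, IsTestFunction w ∧ eLpNorm (w - u) q ≤ ε ∧ eLpNorm (∇ w - G) 2 ≤ ε := by
  have hε2 : ε / 2 ≠ 0 := (ENNReal.half_pos hε).ne'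
  obtain ⟨δ₁, hδ₁, h1⟩ := exists_eLpNorm_normed_convolution_sub_le hq hq' huq hε2
  obtain ⟨δ₂, hδ₂, h2⟩ := exists_eLpNorm_normed_convolution_sub_le one_le_two (by simp) hG2 hε2
  obtain ⟨δ, hδ, hδm⟩ := exists_between (lt_min hδ₁ hδ₂)
  let ρ : ContDiffBump (0 : R3) := ⟨δ / 2, δ, half_pos hδ, half_lt_self hδ⟩
  have hgr := gradient_normed_convolution ρ hG
  set f : R3 → ℝ := ρ.normed volume ⋆[lsmul ℝ ℝ] u with hf
  have hρ : ContDiff ℝ ∞ (ρ.normed (volume : Measure R3)) := ρ.contDiff_normed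
  have hfc : ContDiff ℝ ∞ f :=
    ρ.hasCompactSupport_normed.contDiff_convolution_left (lsmul ℝ ℝ) hρ hG.1
  have hfq : MemLp f q := ⟨hfc.continuous.aestronglyMeasurable,
    (eLpNorm_normed_convolution_le ρ hq hq' huq.1).trans_lt huq.2⟩
  have hf2 : MemLp (∇ f) 2 := by
    refine ⟨(continuous_gradient hfc).aestronglyMeasurable, ?_⟩
    rw [hgr]
    exact (eLpNorm_normed_convolution_le ρ one_le_two (by simp) hG2.1).trans_lt hG2.2
  obtain ⟨w, hw, hw1, hw2⟩ := exists_testFunction_of_contDiff hq' hr hfc hfq hf2 hε2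
  refine ⟨w, hw, ?_, ?_⟩
  · rw [← sub_add_sub_cancel w f u, ← ENNReal.add_halves ε]
    exact (eLpNorm_add_le ((hw.memLp q).1.sub hfq.1) (hfq.1.sub huq.1) hq).trans
      (add_le_add hw1 (h1 ρ (hδm.trans_le (min_le_left _ _))))
  · rw [← sub_add_sub_cancel (∇ w) (∇ f) G, ← ENNReal.add_halves ε]
    refine (eLpNorm_add_le ((hw.memLp_gradient 2).1.sub hf2.1) (hf2.1.sub hG2.1) one_le_two).trans
      (add_le_add hw2 ?_)
    rw [hgr]
    exact h2 ρ (hδm.trans_le (min_le_right _ _))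

theorem exists_seq_testFunction_tendsto {q : ℝ≥0∞} (r : ℝ≥0∞) [ENNReal.HolderTriple q r 2]
    (hq : 1 ≤ q) (hq' : q ≠ ⊤) (hr : 3 ≤ r) {u : R3 → ℝ} {G : R3 → R3} (hG : HasWeakGradient u G)
    (huq : MemLp u q) (hG2 : MemLp G 2) :
    ∃ w : ℕ → R3 → ℝ, (∀ n, IsTestFunction (w n)) ∧
      Tendsto (fun n => eLpNorm (w n - u) q) atTop (𝓝 0) ∧
      Tendsto (fun n => eLpNorm (∇ (w n) - G) 2) atTop (𝓝 0) := by
  have hε : ∀ n : ℕ, ((n : ℝ≥0∞))⁻¹ ≠ 0 := fun n => by simp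
  choose w hw h1 h2 using fun n : ℕ =>
    exists_testFunction_eLpNorm_sub_le r hq hq' hr hG huq hG2 (hε n)
  have h0 := ENNReal.tendsto_inv_nat_nhds_zero
  exact ⟨w, hw, tendsto_of_tendsto_of_tendsto_of_le_of_le tendsto_const_nhds h0
    (fun _ => zero_le) h1, tendsto_of_tendsto_of_tendsto_of_le_of_le tendsto_const_nhds h0
    (fun _ => zero_le) h2⟩

/-! ### Weak gradients and the Sobolev embedding -/

theorem HasWeakGradient.ae_eq {u : R3 → ℝ} {G G' : R3 → R3} (h : HasWeakGradient u G)
    (h' : HasWeakGradient u G') : G =ᵐ[volume] G' :=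
  ae_eq_of_integral_contDiff_smul_eq h.2.1 h'.2.1 fun v hv hvc =>
    neg_injective ((h.2.2 v ⟨hv, hvc⟩).symm.trans (h'.2.2 v ⟨hv, hvc⟩))

theorem HasWeakGradient.weakGradient {u : R3 → ℝ} {G : R3 → R3} (h : HasWeakGradient u G) :
    HasWeakGradient u (weakGradient u) := by
  have hex : ∃ G, HasWeakGradient u G := ⟨G, h⟩
  rw [SchrodingerMaxwell.weakGradient, dif_pos hex]
  exact hex.choose_spec

theorem HasWeakGradient.memLp_weakGradient {u : R3 → ℝ} {G : R3 → R3} (h : HasWeakGradient u G)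
    (hG : MemLp G 2) : MemLp (SchrodingerMaxwell.weakGradient u) 2 :=
  hG.ae_eq (h.ae_eq h.weakGradient)

instance holderTriple_six_three_two : ENNReal.HolderTriple 6 3 2 := ⟨by
  rw [← ENNReal.toReal_eq_toReal_iff' (by simp) (by simp), ENNReal.toReal_add (by simp) (by simp)]
  norm_num⟩

theorem MemH1.exists_seq {u : R3 → ℝ} (hu : MemH1 u) :
    ∃ w : ℕ → R3 → ℝ, (∀ n, IsTestFunction (w n)) ∧
      Tendsto (fun n => eLpNorm (w n - u) 2) atTop (𝓝 0) ∧
      Tendsto (fun n => eLpNorm (∇ (w n) - weakGradient u) 2) atTop (𝓝 0) := by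
  obtain ⟨hu2, G, hG, hG2⟩ := hu
  exact exists_seq_testFunction_tendsto ⊤ one_le_two (by simp) le_top hG.weakGradient hu2
    (hG.memLp_weakGradient hG2)

theorem MemD12.exists_seq {φ : R3 → ℝ} (hφ : MemD12 φ) :
    ∃ w : ℕ → R3 → ℝ, (∀ n, IsTestFunction (w n)) ∧
      Tendsto (fun n => eLpNorm (w n - φ) 6) atTop (𝓝 0) ∧
      Tendsto (fun n => eLpNorm (∇ (w n) - weakGradient φ) 2) atTop (𝓝 0) := by
  obtain ⟨hφ6, G, hG, hG2⟩ := hφ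
  exact exists_seq_testFunction_tendsto 3 (by norm_num) (by simp) le_rfl hG.weakGradient hφ6
    (hG.memLp_weakGradient hG2)

theorem MemH1.memLp_weakGradient {u : R3 → ℝ} (hu : MemH1 u) : MemLp (weakGradient u) 2 :=
  let ⟨_, _, hG, hG2⟩ := hu; hG.memLp_weakGradient hG2

theorem MemD12.memLp_weakGradient {u : R3 → ℝ} (hu : MemD12 u) : MemLp (weakGradient u) 2 :=
  let ⟨_, _, hG, hG2⟩ := hu; hG.memLp_weakGradient hG2

/-- The Sobolev embedding `H¹(ℝ³) ⊆ L⁶(ℝ³)`: the Gagliardo-Nirenberg-Sobolev inequality bounds the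
`L⁶` norms of approximating test functions, and Fatou's lemma passes to the limit. -/
theorem MemH1.memLp_six {u : R3 → ℝ} (hu : MemH1 u) : MemLp u 6 := by
  obtain ⟨w, hw, h1, h2⟩ := hu.exists_seq
  have hG := hu.memLp_weakGradient
  refine ⟨hu.1.1, ?_⟩
  obtain ⟨ns, hns, hae⟩ := (tendstoInMeasure_of_tendsto_eLpNorm (by simp)
    (fun n => ((hw n).memLp 2).1) hu.1.1 h1).exists_seq_tendsto_ae
  set S : NNReal := SNormLESNormFDerivOfEqConst ℝ (volume : Measure R3) 2 with hS
  have hsob : ∀ n, eLpNorm (w n) 6 ≤ S * eLpNorm (∇ (w n)) 2 := fun n => by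
    have := eLpNorm_le_eLpNorm_fderiv_of_eq (μ := (volume : Measure R3)) (p := 2) (p' := 6)
      ((hw n).1.of_le (by simp)) (hw n).2 one_le_two (by simp) (by simp; norm_num)
    refine this.trans_eq ?_
    congr 1
    exact eLpNorm_congr_norm_ae (Eventually.of_forall fun x => (norm_gradient x).symm)
  have hbd : ∀ᶠ k in atTop, eLpNorm (w (ns k)) 6 ≤ S * (1 + eLpNorm (weakGradient u) 2) := by
    filter_upwards [hns.tendsto_atTop.eventually (h2.eventually_le_const one_pos)] with k hk
    refine (hsob _).trans (mul_le_mul_right ?_ _)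
    have hm : AEStronglyMeasurable (∇ (w (ns k)) - weakGradient u) :=
      ((hw _).memLp_gradient 2).1.sub hG.1
    have := eLpNorm_add_le hm hG.1 one_le_two
    rw [sub_add_cancel] at this
    exact this.trans (add_le_add hk le_rfl)
  refine (Lp.eLpNorm_le_of_ae_tendsto hbd (fun k => ((hw _).memLp 6).1) hae).trans_lt ?_
  exact ENNReal.mul_lt_top (by simp [hS]) (ENNReal.add_lt_top.2 ⟨by simp, hG.2⟩)

/-! ### Integrability and passage to the limit -/

theorem integrable_rpow_of_memLp_two_six {u : R3 → ℝ} (h2 : MemLp u 2) (h6 : MemLp u 6) {s : ℝ}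
    (hs : 2 ≤ s) (hs' : s ≤ 6) : Integrable fun x => |u x| ^ s := by
  have i2 : Integrable fun x => |u x| ^ (2 : ℝ) := by
    simpa using h2.integrable_norm_rpow (by simp) (by simp)
  have i6 : Integrable fun x => |u x| ^ (6 : ℝ) := by
    simpa using h6.integrable_norm_rpow (by simp) (by simp)
  refine (i2.add i6).mono' ((h2.1.aemeasurable.abs.pow_const s).aestronglyMeasurable)
    (Eventually.of_forall fun x => ?_)
  rw [Real.norm_of_nonneg (by positivity)]
  have h2 : (0 : ℝ) ≤ |u x| ^ (2 : ℝ) := by positivity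
  have h6 : (0 : ℝ) ≤ |u x| ^ (6 : ℝ) := by positivity
  rcases le_total 1 |u x| with h | h
  · exact (Real.rpow_le_rpow_of_exponent_le h hs').trans (le_add_of_nonneg_left h2)
  · rcases (abs_nonneg (u x)).eq_or_lt with h0 | h0
    · rw [Pi.add_apply, ← h0, Real.zero_rpow (by linarith)]
      positivity
    · exact (Real.rpow_le_rpow_of_exponent_ge h0 h hs).trans (le_add_of_nonneg_right h6)

theorem memLp_of_memLp_two_six {u : R3 → ℝ} (h2 : MemLp u 2) (h6 : MemLp u 6) {s : ℝ}
    (hs : 2 ≤ s) (hs' : s ≤ 6) : MemLp u (ENNReal.ofReal s) := by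
  rw [← integrable_norm_rpow_iff h2.1 (by simp; linarith) (by simp),
    ENNReal.toReal_ofReal (by linarith)]
  exact integrable_rpow_of_memLp_two_six h2 h6 hs hs'

theorem integrable_inner_of_memLp {F : Type*} [NormedAddCommGroup F] [InnerProductSpace ℝ F]
    {p q : ℝ≥0∞} [ENNReal.HolderTriple p q 1] {f h : R3 → F} (hf : MemLp f p) (hh : MemLp h q) :
    Integrable fun x => inner ℝ (f x) (h x) :=
  memLp_one_iff_integrable.1 (hf.of_bilin (fun a b => inner ℝ a b) 1 hh (hf.1.inner hh.1)
    (Eventually.of_forall fun x => by simpa using nnnorm_inner_le_nnnorm (𝕜 := ℝ) _ _))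

theorem tendsto_integral_inner {F : Type*} [NormedAddCommGroup F] [InnerProductSpace ℝ F]
    {p q : ℝ≥0∞} [ENNReal.HolderTriple p q 1] {f : R3 → F} {h : R3 → F} {hn : ℕ → R3 → F}
    (hf : MemLp f p) (hh : MemLp h q) (hhn : ∀ n, MemLp (hn n) q)
    (hlim : Tendsto (fun n => eLpNorm (hn n - h) q) atTop (𝓝 0)) :
    Tendsto (fun n => ∫ x, inner ℝ (f x) (hn n x)) atTop (𝓝 (∫ x, inner ℝ (f x) (h x))) := by
  refine tendsto_integral_of_L1 _ (integrable_inner_of_memLp hf hh).1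
    (Eventually.of_forall fun n => integrable_inner_of_memLp hf (hhn n)) ?_
  have hle : ∀ n, ∫⁻ x, ‖inner ℝ (f x) (hn n x) - inner ℝ (f x) (h x)‖ₑ
      ≤ eLpNorm f p * eLpNorm (hn n - h) q := fun n => by
    rw [← eLpNorm_one_eq_lintegral_enorm]
    have := eLpNorm_le_eLpNorm_mul_eLpNorm_of_nnnorm (p := p) (q := q) (r := 1) hf.1
      ((hhn n).1.sub hh.1) (fun a b => inner ℝ a b) 1
      (Eventually.of_forall fun x => by simpa using nnnorm_inner_le_nnnorm (𝕜 := ℝ) _ _)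
    simpa [inner_sub_right] using this
  refine tendsto_of_tendsto_of_tendsto_of_le_of_le tendsto_const_nhds ?_ (fun _ => zero_le) hle
  simpa using ENNReal.Tendsto.const_mul hlim (Or.inr hf.2.ne)

theorem tendsto_integral_mul {p q : ℝ≥0∞} [ENNReal.HolderTriple p q 1] {f h : R3 → ℝ}
    {hn : ℕ → R3 → ℝ} (hf : MemLp f p) (hh : MemLp h q) (hhn : ∀ n, MemLp (hn n) q)
    (hlim : Tendsto (fun n => eLpNorm (hn n - h) q) atTop (𝓝 0)) :
    Tendsto (fun n => ∫ x, f x * hn n x) atTop (𝓝 (∫ x, f x * h x)) := by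
  simpa [mul_comm] using tendsto_integral_inner hf hh hhn hlim

theorem tendsto_eLpNorm_norm_sub_norm {F : Type*} [NormedAddCommGroup F] {q : ℝ≥0∞} {h : R3 → F}
    {hn : ℕ → R3 → F} (hlim : Tendsto (fun n => eLpNorm (hn n - h) q) atTop (𝓝 0)) :
    Tendsto (fun n => eLpNorm ((fun x => ‖hn n x‖) - fun x => ‖h x‖) q) atTop (𝓝 0) := by
  refine tendsto_of_tendsto_of_tendsto_of_le_of_le tendsto_const_nhds hlim (fun _ => zero_le)
    fun n => eLpNorm_mono fun x => ?_
  simpa using abs_norm_sub_norm_le (hn n x) (h x)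

/-- `x ↦ √(v² + ε²) - ε` is a smooth compactly supported approximation of `|v|` whose gradient is
dominated by that of `v`. -/
theorem IsTestFunction.smoothAbs {v : R3 → ℝ} (hv : IsTestFunction v) {ε : ℝ} (hε : 0 < ε) :
    IsTestFunction (fun x => √(v x ^ 2 + ε ^ 2) - ε) ∧
      ∀ x, ‖(∇ fun x => √(v x ^ 2 + ε ^ 2) - ε) x‖ ≤ ‖(∇ v) x‖ := by
  have hpos : ∀ y : ℝ, y ^ 2 + ε ^ 2 ≠ 0 := fun y => by positivity
  refine ⟨⟨(((hv.1.pow 2).add contDiff_const).sqrt fun x => hpos _).sub contDiff_const,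
    hv.2.comp_left (g := fun y => √(y ^ 2 + ε ^ 2) - ε) (by simp [Real.sqrt_sq hε.le])⟩,
    fun x => ?_⟩
  have h1 : HasDerivAt (fun y : ℝ => √(y ^ 2 + ε ^ 2) - ε)
      (2 * v x / (2 * √(v x ^ 2 + ε ^ 2))) (v x) := by
    have h := (((hasDerivAt_pow 2 (v x)).add_const (ε ^ 2)).sqrt (hpos _)).sub_const ε
    simpa using h
  have h2 := h1.comp_hasFDerivAt x (hv.1.differentiable (by simp) x).hasFDerivAt
  have h3 : fderiv ℝ (fun x => √(v x ^ 2 + ε ^ 2) - ε) x = _ := h2.fderiv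
  rw [norm_gradient, norm_gradient, h3, norm_smul]
  refine mul_le_of_le_one_left (norm_nonneg _) ?_
  have hs : 0 < √(v x ^ 2 + ε ^ 2) := Real.sqrt_pos.2 (by positivity)
  rw [mul_div_mul_left _ _ two_ne_zero, norm_div, Real.norm_of_nonneg hs.le, div_le_one hs]
  exact Real.abs_le_sqrt (le_add_of_nonneg_right (sq_nonneg ε))

/-! ### The Maxwell equation -/

section Maxwell

variable {u φ : R3 → ℝ}

theorem MemH1.memLp (hu : MemH1 u) {s : ℝ} (hs : 2 ≤ s) (hs' : s ≤ 6) :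
    MemLp u (ENNReal.ofReal s) :=
  memLp_of_memLp_two_six hu.1 hu.memLp_six hs hs'

theorem MemH1.memLp_three (hu : MemH1 u) : MemLp u 3 := by
  simpa using hu.memLp (s := 3) (by norm_num) (by norm_num)

theorem MemH1.memLp_sq (hu : MemH1 u) {s : ℝ} (hs : 1 ≤ s) (hs' : s ≤ 3) :
    MemLp (fun x => u x ^ 2) (ENNReal.ofReal s) := by
  have hm : AEStronglyMeasurable (fun x => u x ^ 2) := hu.1.1.pow 2
  rw [← integrable_norm_rpow_iff hm (by simp; linarith) (by simp),
    ENNReal.toReal_ofReal (by linarith)]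
  refine (integrable_rpow_of_memLp_two_six hu.1 hu.memLp_six (s := 2 * s) (by linarith)
    (by linarith)).congr (Eventually.of_forall fun x => ?_)
  simp only [norm_pow, Real.norm_eq_abs]
  rw [Real.rpow_mul (abs_nonneg _), Real.rpow_two]

theorem MemH1.memLp_sq_two (hu : MemH1 u) : MemLp (fun x => u x ^ 2) 2 := by
  simpa using hu.memLp_sq (s := 2) (by norm_num) (by norm_num)

/-- Any element of `D^{1,2}` is admissible in the weak Maxwell equation. -/
theorem SolvesMaxwell.integral_inner_weakGradient (h : SolvesMaxwell u φ) (hu : MemH1 u)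
    {ψ : R3 → ℝ} (hψ : MemD12 ψ) :
    ∫ x, inner ℝ (weakGradient φ x) (weakGradient ψ x) = ∫ x, u x ^ 2 * ψ x := by
  obtain ⟨w, hw, h1, h2⟩ := hψ.exists_seq
  -- `u²` pairs with `L⁶` because `u ∈ L^{12/5}`
  have : ENNReal.HolderTriple (ENNReal.ofReal (6 / 5)) 6 1 := ⟨by
    rw [← ENNReal.toReal_eq_toReal_iff' (by simp) (by simp), ENNReal.toReal_add (by simp) (by simp)]
    norm_num [ENNReal.toReal_inv]⟩
  have t1 := tendsto_integral_inner h.1.memLp_weakGradient hψ.memLp_weakGradient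
    (fun n => (hw n).memLp_gradient 2) h2
  have t2 := tendsto_integral_mul (hu.memLp_sq (s := 6 / 5) (by norm_num) (by norm_num)) hψ.1
    (fun n => (hw n).memLp 6) h1
  simp only [h.2 _ (hw _)] at t1
  exact tendsto_nhds_unique t1 t2

theorem SolvesMaxwell.integral_sq_mul_abs_le (h : SolvesMaxwell u φ) (hu : MemH1 u)
    {v : R3 → ℝ} (hv : IsTestFunction v) :
    ∫ x, u x ^ 2 * |v x| ≤ ∫ x, ‖weakGradient φ x‖ * ‖(∇ v) x‖ := by
  have hφ := h.1.memLp_weakGradient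
  have hu2 : Integrable fun x => u x ^ 2 := hu.1.integrable_sq
  have hb : 0 ≤ ∫ x, u x ^ 2 := integral_nonneg fun x => sq_nonneg _
  refine le_of_forall_pos_le_add fun δ hδ => ?_
  set b := ∫ x, u x ^ 2 with hbdef
  -- the error made by replacing `|v|` is at most `ε b`
  set ε := δ / (b + 1) with hεdef
  have hε : 0 < ε := by positivity
  have hεb : ε * b ≤ δ := by
    rw [hεdef, div_mul_eq_mul_div, div_le_iff₀ (by positivity)]
    nlinarith
  obtain ⟨ht, hgr⟩ := hv.smoothAbs hε
  have hint1 : Integrable fun x => u x ^ 2 * |v x| :=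
    hu.memLp_sq_two.integrable_mul (hv.memLp 2).abs
  have hint2 : Integrable fun x => u x ^ 2 * (√(v x ^ 2 + ε ^ 2) - ε) :=
    hu.memLp_sq_two.integrable_mul (ht.memLp 2)
  have hint3 : Integrable fun x => ‖weakGradient φ x‖ * ‖(∇ v) x‖ :=
    hφ.norm.integrable_mul (hv.memLp_gradient 2).norm
  have e1 : ∫ x, u x ^ 2 * |v x| ≤ (∫ x, u x ^ 2 * (√(v x ^ 2 + ε ^ 2) - ε)) + ε * b := by
    rw [hbdef, ← integral_const_mul, ← integral_add hint2 (hu2.const_mul ε)]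
    refine integral_mono hint1 (hint2.add (hu2.const_mul ε)) fun x => ?_
    have : |v x| ≤ √(v x ^ 2 + ε ^ 2) :=
      Real.abs_le_sqrt (le_add_of_nonneg_right (sq_nonneg ε))
    have := mul_le_mul_of_nonneg_left this (sq_nonneg (u x))
    simp only
    linarith
  have e2 : ∫ x, u x ^ 2 * (√(v x ^ 2 + ε ^ 2) - ε) ≤ ∫ x, ‖weakGradient φ x‖ * ‖(∇ v) x‖ := by
    rw [← h.2 _ ht]
    refine integral_mono (integrable_inner_of_memLp hφ (ht.memLp_gradient 2)) hint3 fun x => ?_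
    exact (real_inner_le_norm _ _).trans (mul_le_mul_of_nonneg_left (hgr x) (norm_nonneg _))
  linarith

/-- The key estimate: the Maxwell equation tested with `|u|`. -/
theorem SolvesMaxwell.integral_abs_pow_three_le (h : SolvesMaxwell u φ) (hu : MemH1 u) :
    ∫ x, |u x| ^ 3 ≤ ∫ x, ‖weakGradient φ x‖ * ‖weakGradient u x‖ := by
  obtain ⟨w, hw, h1, h2⟩ := hu.exists_seq
  have t1 := tendsto_integral_mul hu.memLp_sq_two hu.1.norm (fun n => ((hw n).memLp 2).norm)
    (tendsto_eLpNorm_norm_sub_norm h1)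
  have t2 := tendsto_integral_mul h.1.memLp_weakGradient.norm hu.memLp_weakGradient.norm
    (fun n => ((hw n).memLp_gradient 2).norm) (tendsto_eLpNorm_norm_sub_norm h2)
  have hle := le_of_tendsto_of_tendsto' t1 t2 fun n => h.integral_sq_mul_abs_le hu (hw n)
  refine le_trans (le_of_eq (integral_congr_ae (Eventually.of_forall fun x => ?_))) hle
  simp only [Real.norm_eq_abs]
  rw [pow_succ, sq_abs]

/-- The potential integrates against `u²` like any solution of the Maxwell equation, by testing the
equation of either one with the other. -/
theorem SolvesMaxwell.integral_potential (h : SolvesMaxwell u φ) (hu : MemH1 u) :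
    ∫ x, potential u x * u x ^ 2 = ∫ x, ‖weakGradient φ x‖ ^ 2 := by
  have hex : ∃ φ, SolvesMaxwell u φ := ⟨φ, h⟩
  have hpot : SolvesMaxwell u (potential u) := by
    rw [potential, dif_pos hex]; exact hex.choose_spec
  have e1 := h.integral_inner_weakGradient hu hpot.1
  have e2 := hpot.integral_inner_weakGradient hu h.1
  have e3 := h.integral_inner_weakGradient hu h.1
  simp only [real_inner_self_eq_norm_sq] at e3
  simp only [mul_comm (potential u _)]
  rw [e3, ← e2, ← e1]
  exact integral_congr_ae (Eventually.of_forall fun x => real_inner_comm _ _)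

end Maxwell

/-! ### The energy of a solution -/

/-- The Nehari identity: the Schrödinger equation tested with `u`. -/
theorem IsSolution.nehari {lam p : ℝ} {g u φ : R3 → ℝ} (h : IsSolution lam p g u φ)
    (hp : p ∈ Ioc (1 : ℝ) 2) (hg : MemLp g 2) :
    (∫ x, ‖weakGradient u x‖ ^ 2) + (∫ x, u x ^ 2) + lam * (∫ x, ‖weakGradient φ x‖ ^ 2)
      = (∫ x, |u x| ^ (p + 1)) + ∫ x, g x * u x := by
  have hu := h.memH1
  obtain ⟨w, hw, h1, h2⟩ := hu.exists_seq
  have hwm := fun n => (hw n).memLp 2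
  have hpow : MemLp (fun x => |u x| ^ (p - 1) * u x) 2 := by
    have hm : AEStronglyMeasurable (fun x => |u x| ^ (p - 1) * u x) :=
      (hu.1.1.aemeasurable.abs.pow_const _).aestronglyMeasurable.mul hu.1.1
    rw [← integrable_norm_rpow_iff hm (by simp) (by simp)]
    refine (integrable_rpow_of_memLp_two_six hu.1 hu.memLp_six (s := p * 2) (by linarith [hp.1])
      (by linarith [hp.2])).congr (Eventually.of_forall fun x => ?_)
    have : ‖|u x| ^ (p - 1) * u x‖ = |u x| ^ p := by
      rw [norm_mul, Real.norm_eq_abs, Real.norm_eq_abs, abs_of_nonneg (by positivity),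
        ← Real.rpow_add_one' (abs_nonneg _) (by linarith [hp.1]), sub_add_cancel]
    simp only [this, ENNReal.toReal_ofNat]
    rw [Real.rpow_mul (abs_nonneg _)]
  have hφu : MemLp (fun x => φ x * u x) 2 := hu.memLp_three.mul' h.maxwell.1.1
  have t1 := tendsto_integral_inner hu.memLp_weakGradient hu.memLp_weakGradient
    (fun n => (hw n).memLp_gradient 2) h2
  have t2 := tendsto_integral_mul hu.1 hu.1 hwm h1
  have t3 := tendsto_integral_mul hφu hu.1 hwm h1
  have t4 := tendsto_integral_mul hpow hu.1 hwm h1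
  have t5 := tendsto_integral_mul hg hu.1 hwm h1
  have key := tendsto_nhds_unique (((t1.add t2).add (t3.const_mul lam)).congr
    fun n => h.schrodinger _ (hw n)) (t4.add t5)
  simp only [real_inner_self_eq_norm_sq] at key
  have e3 := h.maxwell.integral_inner_weakGradient hu h.maxwell.1
  simp only [real_inner_self_eq_norm_sq] at e3
  have f1 : ∀ x, u x * u x = u x ^ 2 := fun x => (sq _).symm
  have f2 : ∀ x, φ x * u x * u x = u x ^ 2 * φ x := fun x => by ring
  have f3 : ∀ x, |u x| ^ (p - 1) * u x * u x = |u x| ^ (p + 1) := fun x => by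
    rw [mul_assoc, ← abs_mul_abs_self (u x), ← mul_assoc,
      ← Real.rpow_add_one' (abs_nonneg _) (by linarith [hp.1]), sub_add_cancel,
      ← Real.rpow_add_one' (abs_nonneg _) (by linarith [hp.1])]
  simpa only [f1, f2, f3, ← e3] using key

/-- The only place where `p ≤ 2` is essential: the exponent `p + 1` then lies between `2` and `3`,
and the coefficient of `t ^ 2` can be made as small as desired. -/
theorem exists_rpow_le_sq_add_pow_three {p : ℝ} (hp : p ∈ Ioc (1 : ℝ) 2) :
    ∃ K : ℝ, 0 < K ∧ ∀ t : ℝ, 0 ≤ t → t ^ (p + 1) ≤ 1 / 2 * t ^ 2 + K * t ^ 3 := by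
  have hp1 : 0 < p - 1 := sub_pos.2 hp.1
  -- the threshold up to which `t ^ (p - 1) ≤ 1 / 2`
  set T : ℝ := (1 / 2 : ℝ) ^ (p - 1)⁻¹ with hT
  have hT0 : 0 < T := by positivity
  have hTp : T ^ (p - 1) = 1 / 2 := Real.rpow_inv_rpow (by norm_num) hp1.ne'
  refine ⟨T ^ (p - 2), by positivity, fun t ht => ?_⟩
  rcases ht.eq_or_lt with rfl | ht
  · rw [Real.zero_rpow (by linarith)]; simp
  have e1 : t ^ (p + 1) = t ^ 2 * t ^ (p - 1) := by
    rw [← Real.rpow_natCast t 2, ← Real.rpow_add ht]; congr 1; push_cast; ring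
  have e2 : t ^ (p - 1) = t * t ^ (p - 2) := by
    rw [mul_comm, ← Real.rpow_add_one ht.ne']; congr 1; ring
  have key : t ^ (p - 1) ≤ 1 / 2 + T ^ (p - 2) * t := by
    rcases le_total t T with h | h
    · have := Real.rpow_le_rpow ht.le h hp1.le
      rw [hTp] at this
      have : 0 ≤ T ^ (p - 2) * t := by positivity
      linarith
    · have := Real.rpow_le_rpow_of_nonpos hT0 h (sub_nonpos.2 hp.2)
      rw [e2]
      nlinarith
  rw [e1]
  have := mul_le_mul_of_nonneg_left key (sq_nonneg t)
  nlinarith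

/-- For `λ ≥ K²` the coupling term dominates and every solution has nonpositive energy. -/
theorem IsSolution.energy_nonpos {lam p K : ℝ} {g u φ : R3 → ℝ} (h : IsSolution lam p g u φ)
    (hp : p ∈ Ioc (1 : ℝ) 2) (hg : MemLp g 2)
    (hK0 : 0 ≤ K) (hK : ∀ t : ℝ, 0 ≤ t → t ^ (p + 1) ≤ 1 / 2 * t ^ 2 + K * t ^ 3)
    (hlam : K ^ 2 ≤ lam) : energy lam p g u ≤ 0 := by
  have hu := h.memH1
  have hp0 : 0 < p + 1 := by linarith [hp.1]
  have hGu := hu.memLp_weakGradient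
  have hGφ := h.maxwell.1.memLp_weakGradient
  have ia : Integrable fun x => ‖weakGradient u x‖ ^ 2 := hGu.norm.integrable_sq
  have iD : Integrable fun x => ‖weakGradient φ x‖ ^ 2 := hGφ.norm.integrable_sq
  have ib : Integrable fun x => u x ^ 2 := hu.1.integrable_sq
  have i3 : Integrable fun x => |u x| ^ 3 := by
    simpa using hu.memLp_three.integrable_norm_pow (by simp)
  have iP : Integrable fun x => |u x| ^ (p + 1) :=
    integrable_rpow_of_memLp_two_six hu.1 hu.memLp_six (by linarith [hp.1]) (by linarith [hp.2])
  have iX : Integrable fun x => ‖weakGradient φ x‖ * ‖weakGradient u x‖ :=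
    hGφ.norm.integrable_mul hGu.norm
  have hN := h.nehari hp hg
  have hcub := h.maxwell.integral_abs_pow_three_le hu
  rw [energy, integral_add ia ib, h.maxwell.integral_potential hu]
  have hP : ∫ x, |u x| ^ (p + 1) ≤ 1 / 2 * (∫ x, u x ^ 2) + K * ∫ x, |u x| ^ 3 := by
    rw [← integral_const_mul, ← integral_const_mul,
      ← integral_add (ib.const_mul _) (i3.const_mul _)]
    refine integral_mono iP ((ib.const_mul _).add (i3.const_mul _)) fun x => ?_
    simpa using hK |u x| (abs_nonneg _)
  have hY : K * (∫ x, ‖weakGradient φ x‖ * ‖weakGradient u x‖)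
      ≤ 1 / 2 * (∫ x, ‖weakGradient u x‖ ^ 2) + K ^ 2 / 2 * ∫ x, ‖weakGradient φ x‖ ^ 2 := by
    rw [← integral_const_mul, ← integral_const_mul, ← integral_const_mul,
      ← integral_add (ia.const_mul _) (iD.const_mul _)]
    refine integral_mono (iX.const_mul _) ((ia.const_mul _).add (iD.const_mul _)) fun x => ?_
    simp only
    nlinarith [sq_nonneg (K * ‖weakGradient φ x‖ - ‖weakGradient u x‖)]
  have hP0 : 0 ≤ ∫ x, |u x| ^ (p + 1) := integral_nonneg fun x => by positivity
  have hD0 : 0 ≤ ∫ x, ‖weakGradient φ x‖ ^ 2 := integral_nonneg fun x => by positivity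
  have hq : 0 ≤ 1 / (p + 1) * ∫ x, |u x| ^ (p + 1) := by positivity
  have hcub' := mul_le_mul_of_nonneg_left hcub hK0
  have hl := mul_le_mul_of_nonneg_right hlam hD0
  have hK2 : 0 ≤ K ^ 2 * ∫ x, ‖weakGradient φ x‖ ^ 2 := by positivity
  linarith

end SchrodingerMaxwell

theorem theorem4p1 (p : ℝ) (hp : p ∈ Set.Ioc (1 : ℝ) 2)
    (g : SchrodingerMaxwell.R3 → ℝ) (hg : MemLp g 2) :
    ∃ lam₀ : ℝ, 0 < lam₀ ∧ ∀ lam : ℝ, lam₀ ≤ lam →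
      ¬ ∃ u φ : SchrodingerMaxwell.R3 → ℝ,
        SchrodingerMaxwell.IsSolution lam p g u φ ∧
          0 < SchrodingerMaxwell.energy lam p g u := by
  obtain ⟨K, hK0, hK⟩ := SchrodingerMaxwell.exists_rpow_le_sq_add_pow_three hp
  refine ⟨K ^ 2, by positivity, fun lam hlam => ?_⟩
  rintro ⟨u, φ, hsol, hpos⟩
  exact hpos.not_ge (hsol.energy_nonpos hp hg hK0.le hK hlam)
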